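/- Let $L$ be a locale, identified with its frame of opens. Call a locale $P$ \emph{zero-dimensional} if every element of $P$ is a join of complemented elements, and \emph{locally zero-dimensional} if there is a set $\mathcal{U} \subseteq P$ with $\bigvee \mathcal{U} = \top$ such that for every $U \in \mathcal{U}$ the open sublocale $\{V \in P \mid V \le U\}$ is zero-dimensional. Call an object $X$ of a (Grothendieck) topos $\mathcal{E}$ \emph{zero-dimensional} (resp. \emph{locally zero-dimensional}) if its frame of subobjects $\operatorname{Sub}(X)$ is zero-dimensional (resp. locally zero-dimensional) as a locale, and call $\mathcal{E}$ \emph{locally zero-dimensional} if it has a generating set of zero-dimensional objects. Let $\mathbf{Sh}(L)$ be the topos of sheaves of sets on $L$. Then the following are equivalent: (i) $L$ is a locally zero-dimensional locale; (ii) $\mathbf{Sh}(L)$ is a locally zero-dimensional topos; (iii) every object of $\mathbf{Sh}(L)$ is locally zero-dimensional. -/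

import Mathlib

open CategoryTheory

universe u v

/-! ### Zero-dimensional and locally zero-dimensional locales

A frame is determined by its underlying partial order, so the notions are phrased for partial
orders; they can then be applied verbatim to a frame, to the down-set of an element, and to the
poset of subobjects of an object of a category. The lemmas ending in `_iff` say that on bounded and
complete lattices (in particular on frames) they are the usual ones. -/

/-- `a` is complemented: some `b` satisfies `a ⊓ b = ⊥` and `a ⊔ b = ⊤`. -/
def IsComplementedElement {P : Type u} [PartialOrder P] (a : P) : Prop :=
  ∃ b : P, (∀ x, x ≤ a → x ≤ b → IsBot x) ∧ (∀ x, a ≤ x → b ≤ x → IsTop x)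

/-- Every element is a join of complemented elements. -/
def IsZeroDimensional (P : Type u) [PartialOrder P] : Prop :=
  ∀ a : P, ∃ S : Set P, (∀ c ∈ S, IsComplementedElement c) ∧ IsLUB S a

/-- There is a cover `𝒰` (a set of elements whose join is the top element) such that for each
`U ∈ 𝒰` the open sublocale `{V | V ≤ U}` is zero-dimensional. -/
def IsLocallyZeroDimensional (P : Type u) [PartialOrder P] : Prop :=
  ∃ 𝒰 : Set P, (∃ t : P, IsTop t ∧ IsLUB 𝒰 t) ∧ ∀ U ∈ 𝒰, IsZeroDimensional (Set.Iic U)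

theorem isComplementedElement_iff {α : Type u} [Lattice α] [BoundedOrder α] (a : α) :
    IsComplementedElement a ↔ IsComplemented a := by
  constructor
  · rintro ⟨b, h1, h2⟩
    refine ⟨b, disjoint_iff.2 ?_, codisjoint_iff.2 ?_⟩
    · exact (h1 _ inf_le_left inf_le_right).eq_bot
    · exact (h2 _ le_sup_left le_sup_right).eq_top
  · rintro ⟨b, h1, h2⟩
    exact ⟨b, fun x ha hb y => (h1 ha hb).trans bot_le, fun x ha hb y => le_top.trans (h2 ha hb)⟩

theorem isZeroDimensional_iff {α : Type u} [CompleteLattice α] :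
    IsZeroDimensional α ↔ ∀ a : α, ∃ S : Set α, (∀ c ∈ S, IsComplemented c) ∧ sSup S = a := by
  simp only [IsZeroDimensional, isComplementedElement_iff, isLUB_iff_sSup_eq]

theorem isLocallyZeroDimensional_iff {α : Type u} [CompleteLattice α] :
    IsLocallyZeroDimensional α ↔
      ∃ 𝒰 : Set α, sSup 𝒰 = ⊤ ∧ ∀ U ∈ 𝒰, IsZeroDimensional (Set.Iic U) := by
  simp [IsLocallyZeroDimensional, isLUB_iff_sSup_eq, isTop_iff_eq_top]

/-! ### Sheaves on a locale -/

/-- The canonical topology on a frame: a sieve on `U` covers when the join of the elements it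
contains is `U`. -/
def frameTopology (L : Type u) [Order.Frame L] : GrothendieckTopology L where
  sieves U := {S | sSup {V : L | ∃ f : V ⟶ U, S f} = U}
  top_mem' U := by
    refine le_antisymm (sSup_le ?_) (le_sSup ⟨𝟙 U, trivial⟩)
    rintro V ⟨f, -⟩
    exact leOfHom f
  pullback_stable' := by
    intro X Y S f hS
    refine le_antisymm (sSup_le ?_) ?_
    · rintro V ⟨g, -⟩
      exact leOfHom g
    · have hS' : sSup {V : L | ∃ f : V ⟶ X, S f} = X := hS
      have h : Y ⊓ sSup {V : L | ∃ f : V ⟶ X, S f} = Y := by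
        rw [hS']; exact inf_eq_left.2 (leOfHom f)
      rw [inf_sSup_eq] at h
      conv_lhs => rw [← h]
      refine iSup₂_le ?_
      rintro V ⟨g, hg⟩
      refine le_sSup ⟨homOfLE inf_le_left, ?_⟩
      exact S.downward_closed hg (homOfLE (inf_le_right : Y ⊓ V ≤ V))
  transitive' := by
    intro X S hS R hR
    refine le_antisymm (sSup_le ?_) ?_
    · rintro V ⟨g, -⟩
      exact leOfHom g
    · have hS' : sSup {V : L | ∃ f : V ⟶ X, S f} = X := hS
      conv_lhs => rw [← hS']
      refine sSup_le ?_
      rintro V ⟨g, hg⟩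
      have hV : sSup {W : L | ∃ f : W ⟶ V, Sieve.pullback g R f} = V := hR hg
      rw [← hV]
      refine sSup_le ?_
      rintro W ⟨k, hk⟩
      exact le_sSup ⟨k ≫ g, hk⟩

/-- The topos `Sh(L)` of sheaves of sets on the locale `L` (given by its frame of opens). -/
abbrev LocaleSheaf (L : Type u) [Order.Frame L] : Type (u + 1) :=
  Sheaf (frameTopology L) (Type u)

/-! ### Zero-dimensionality in a topos -/

/-- The subobject frame of `X` is zero-dimensional. -/
def IsZeroDimensionalObject {E : Type u} [Category.{v} E] (X : E) : Prop :=
  IsZeroDimensional (Subobject X)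

/-- The subobject frame of `X` is locally zero-dimensional. -/
def IsLocallyZeroDimensionalObject {E : Type u} [Category.{v} E] (X : E) : Prop :=
  IsLocallyZeroDimensional (Subobject X)

/-- The topos `E` has a generating set (a family of objects, indexed by a small type, that
jointly separates parallel morphisms) consisting of zero-dimensional objects. -/
def IsLocallyZeroDimensionalTopos (E : Type u) [Category.{v} E] : Prop :=
  ∃ (ι : Type v) (X : ι → E), (ObjectProperty.ofObj X).IsSeparating ∧
    ∀ i, IsZeroDimensionalObject (X i)

/-!
Write `openSheaf U` for the sheaf on `L` represented by an open `U`, a subterminal object. Two facts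
translate between `L` and its topos of sheaves.

* A morphism `openSheaf U ⟶ F`, that is, a section of `F` over `U`, is a monomorphism, and the
  subobjects of `F` below its image form the frame of opens below `U` (`iicOrderIsoIicMk`). Indeed a
  subobject of `openSheaf U` has at most one section over each open, so these glue to a section
  over the join of the opens that carry one, and that join represents it.
* If the opens in a lower set `D` cover `L`, then the sheaves `openSheaf V` with `V ∈ D` generate
  the topos (`isSeparating_openSheaf`); conversely the opens over which some member of a generating
  family has a section cover `L` (`sSup_section_of_isSeparating`). Since the topos is balanced, a
  generating family also detects when a subobject is everything.

Zero-dimensionality passes to smaller opens (`IsZeroDimensional.Iic_mono`), so a locally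
zero-dimensional `L` is covered by a lower set `D` of zero-dimensional opens. The sheaves they
represent form a generating set, and the images of the sections of a sheaf `F` over members of `D`
cover `F` by zero-dimensional subobjects. In the other direction, if every sheaf is locally
zero-dimensional, then so is the terminal one, whose subobjects are the opens of `L`. If there are
zero-dimensional generators, the opens over which some generator has a section cover `L`, and each
is isomorphic to an open part of the frame of subobjects of that generator, so it is
zero-dimensional.

That an open part of this frame is zero-dimensional uses that subobjects of a sheaf form a
distributive lattice. They are the subfunctors closed under gluing, the fixed points of a nucleus on
the frame of all subfunctors (`closedSubfunctorOrderIso`), hence a frame.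
-/

/-! ### Zero-dimensionality of down-sets -/

section Order

variable {P : Type u} {Q : Type v} [PartialOrder P] [PartialOrder Q]

theorem IsComplementedElement.map_orderIso (e : P ≃o Q) {a : P} (ha : IsComplementedElement a) :
    IsComplementedElement (e a) := by
  obtain ⟨b, h1, h2⟩ := ha
  refine ⟨e b, fun x hxa hxb y => ?_, fun x hxa hxb y => ?_⟩
  · have := h1 (e.symm x) (e.symm_apply_le.2 hxa) (e.symm_apply_le.2 hxb) (e.symm y)
    simpa using this
  · have := h2 (e.symm x) (e.le_symm_apply.2 hxa) (e.le_symm_apply.2 hxb) (e.symm y)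
    simpa using this

theorem IsZeroDimensional.of_orderIso (e : P ≃o Q) (h : IsZeroDimensional P) :
    IsZeroDimensional Q := by
  intro a
  obtain ⟨S, hS, hlub⟩ := h (e.symm a)
  refine ⟨e '' S, ?_, ?_⟩
  · rintro _ ⟨c, hc, rfl⟩
    exact (hS c hc).map_orderIso e
  · rw [e.isLUB_image]
    exact hlub

/-- An order isomorphism restricts to the down-sets of corresponding elements. -/
def OrderIso.iicCongr (e : P ≃o Q) (a : P) : Set.Iic a ≃o Set.Iic (e a) where
  toFun := fun ⟨x, hx⟩ => ⟨e x, e.monotone hx⟩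
  invFun := fun ⟨y, hy⟩ => ⟨e.symm y, e.symm_apply_le.2 hy⟩
  left_inv _ := Subtype.ext (e.symm_apply_apply _)
  right_inv _ := Subtype.ext (e.apply_symm_apply _)
  map_rel_iff' := e.le_iff_le

theorem IsLocallyZeroDimensional.of_orderIso (e : P ≃o Q) (h : IsLocallyZeroDimensional P) :
    IsLocallyZeroDimensional Q := by
  obtain ⟨𝒰, ⟨t, ht, hlub⟩, h⟩ := h
  refine ⟨e '' 𝒰, ⟨e t, fun y => e.symm_apply_le.1 (ht _), ?_⟩, ?_⟩
  · rw [e.isLUB_image, e.symm_apply_apply]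
    exact hlub
  · rintro _ ⟨U, hU, rfl⟩
    exact (h U hU).of_orderIso (e.iicCongr U)

/-- An open part of a zero-dimensional open part is zero-dimensional: if `c` has the complement
`b` in the larger down-set, it has the complement `b ⊓ W` in the smaller one. -/
theorem IsZeroDimensional.Iic_mono {D : Type u} [DistribLattice D] {W U : D} (hWU : W ≤ U)
    (h : IsZeroDimensional (Set.Iic U)) : IsZeroDimensional (Set.Iic W) := by
  rintro ⟨a, ha : a ≤ W⟩
  obtain ⟨S, hS, hub, hle⟩ := h ⟨a, ha.trans hWU⟩
  refine ⟨{c | (⟨c, c.2.trans hWU⟩ : Set.Iic U) ∈ S}, ?_, fun c hc => hub hc, fun x hx => ?_⟩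
  · rintro ⟨c, hcW⟩ hc
    obtain ⟨b, h1, h2⟩ := hS _ hc
    refine ⟨⟨b ⊓ W, inf_le_right⟩, fun x hxc hxb y => ?_, fun x hcx hbx y => ?_⟩
    · exact h1 ⟨x, x.2.trans hWU⟩ hxc (le_inf_iff.1 (show x.1 ≤ b.1 ⊓ W from hxb)).1
        ⟨y, y.2.trans hWU⟩
    · have hcx' : c ≤ x := hcx
      have hbx' : b.1 ⊓ W ≤ x := hbx
      have hU : U ≤ c ⊔ b :=
        h2 ⟨c ⊔ b, sup_le (hcW.trans hWU) b.2⟩ (le_sup_left (a := c)) (le_sup_right (b := b.1))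
          ⟨U, le_rfl⟩
      -- Here distributivity is needed: `b` and `c` cover `W` because they cover `U`.
      have hW : W ≤ x := calc
        W = (c ⊔ b) ⊓ W := (inf_eq_right.2 (hWU.trans hU)).symm
        _ = c ⊓ W ⊔ b.1 ⊓ W := inf_sup_right ..
        _ ≤ x := sup_le (inf_le_left.trans hcx') hbx'
      exact (show y.1 ≤ x.1 from le_trans y.2 hW)
  · exact hle (show (⟨x, x.2.trans hWU⟩ : Set.Iic U) ∈ upperBounds S from fun c hc =>
      hx (show (⟨c, (show c.1 ≤ a from hub hc).trans ha⟩ : Set.Iic W) ∈ _ from hc))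

theorem IsZeroDimensional.Iic {D : Type u} [DistribLattice D] [OrderTop D]
    (h : IsZeroDimensional D) (a : D) : IsZeroDimensional (Set.Iic a) :=
  (h.of_orderIso OrderIso.IicTop.symm).Iic_mono le_top

end Order

/-! ### The frame of subobjects of a sheaf -/

section Nucleus
open Opposite
universe w₁ w₂ w₃
variable {C : Type w₁} [Category.{w₂} C]

instance {F : C ⥤ Type w₃} : Order.Frame (Subfunctor F) :=
  .ofMinimalAxioms
    { inf_sSup_le_iSup_inf := by
        rintro G S U x ⟨hx, hx'⟩
        simp only [Subfunctor.sSup_obj, Subfunctor.iSup_obj, Subfunctor.min_obj,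
          Set.mem_iUnion, Set.mem_sUnion, Set.mem_image, Set.sSup_eq_sUnion] at hx' ⊢
        obtain ⟨_, ⟨T, hT, rfl⟩, hxT⟩ := hx'
        exact ⟨T, hT, hx, hxT⟩ }

variable {J : GrothendieckTopology C}

/-- The nucleus on the subfunctors of a sheaf that closes a subfunctor under gluing: it adds the
sections that locally belong to the subfunctor. -/
def sheafifyNucleus (F : Sheaf J (Type w₃)) : Nucleus (Subfunctor F.obj) where
  toFun G := G.sheafify J
  map_inf' G H := by
    ext U s
    exact J.intersection_covering_iff (R := G.sieveOfSection s) (S := H.sieveOfSection s)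
  idempotent' G := (G.sheafify_sheafify
    ((isSheaf_iff_isSheaf_of_type _ _).1 F.property)).le
  le_apply' G := G.le_sheafify J

theorem mem_range_sheafifyNucleus_iff {F : Sheaf J (Type w₃)} (G : Subfunctor F.obj) :
    G ∈ Set.range (sheafifyNucleus F) ↔ Presieve.IsSheaf J G.toFunctor := by
  rw [← G.eq_sheafify_iff ((isSheaf_iff_isSheaf_of_type _ _).1 F.property)]
  exact Nucleus.mem_range.trans eq_comm

/-- The sheaf underlying a subfunctor that is closed under gluing. -/
def closedSubfunctorSheaf {F : Sheaf J (Type w₃)} (G : Set.range (sheafifyNucleus F)) :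
    Sheaf J (Type w₃) :=
  ⟨G.1.toFunctor,
    (isSheaf_iff_isSheaf_of_type _ _).2 ((mem_range_sheafifyNucleus_iff G.1).1 G.2)⟩

/-- The inclusion of a subfunctor that is closed under gluing. -/
def closedSubfunctorι {F : Sheaf J (Type w₃)} (G : Set.range (sheafifyNucleus F)) :
    closedSubfunctorSheaf G ⟶ F :=
  ⟨G.1.ι⟩

instance {F : Sheaf J (Type w₃)} (G : Set.range (sheafifyNucleus F)) :
    Mono (closedSubfunctorι G) :=
  (sheafToPresheaf J _).mono_of_mono_map (inferInstanceAs (Mono G.1.ι))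

/-- The subobjects of a sheaf of types are its subfunctors closed under gluing; in particular
they form a frame. -/
noncomputable def closedSubfunctorOrderIso [HasSheafify J (Type w₃)] (F : Sheaf J (Type w₃)) :
    Set.range (sheafifyNucleus F) ≃o Subobject F :=
  RelIso.ofSurjective
    (OrderEmbedding.ofMapLEIff (fun G => Subobject.mk (closedSubfunctorι G)) fun G H => by
      constructor
      · intro h U x hx
        have hw := Subobject.ofMkLEMk_comp h
        have := ConcreteCategory.congr_hom
          (NatTrans.congr_app ((sheafToPresheaf J _).congr_map hw) U) ⟨x, hx⟩
        have h2 : x = _ := this.symm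
        rw [h2]
        exact Subtype.property _
      · intro h
        exact Subobject.mk_le_mk_of_comm (ObjectProperty.homMk (Subfunctor.homOfLe h)) rfl)
    (fun A => by
      let f : (A : Sheaf J (Type w₃)).obj ⟶ F.obj := A.arrow.hom
      have : Mono f := inferInstanceAs (Mono ((sheafToPresheaf J _).map A.arrow))
      have hG : Subfunctor.range f ∈ Set.range (sheafifyNucleus F) :=
        (mem_range_sheafifyNucleus_iff _).2 <| Presieve.isSheaf_iso J
          (asIso (Subfunctor.toRange f))
          ((isSheaf_iff_isSheaf_of_type _ _).1 (A : Sheaf J (Type w₃)).property)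
      refine ⟨⟨_, hG⟩, le_antisymm ?_ ?_⟩
      · let g : (Subfunctor.range f).toFunctor ⟶ (A : Sheaf J (Type w₃)).obj :=
          inv (Subfunctor.toRange f)
        refine Subobject.mk_le_of_comm (ObjectProperty.homMk g) ?_
        ext1
        change inv (Subfunctor.toRange f) ≫ f = (Subfunctor.range f).ι
        rw [IsIso.inv_comp_eq]
        rfl
      · exact Subobject.le_mk_of_comm (ObjectProperty.homMk (Subfunctor.toRange f)) rfl)

end Nucleus

/-! ### Opens as sheaves on a locale -/

section Locale

open Opposite

variable {L : Type u} [Order.Frame L]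

/-- A sheaf on a locale with at most one section over each open has a section over the join of the
opens over which it has one. -/
theorem nonempty_section_sSup (A : LocaleSheaf L) (hA : ∀ V, Subsingleton (A.obj.obj V)) :
    Nonempty (A.obj.obj (op (sSup {V : L | Nonempty (A.obj.obj (op V))}))) := by
  let W : L := sSup {V : L | Nonempty (A.obj.obj (op V))}
  let S : Sieve W :=
    { arrows := fun V _ => Nonempty (A.obj.obj (op V))
      downward_closed := fun ⟨x⟩ g => ⟨A.obj.map g.op x⟩ }
  have hS : S ∈ frameTopology L W :=
    le_antisymm (sSup_le fun V ⟨f, _⟩ => leOfHom f)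
      (sSup_le fun V hV => le_sSup ⟨homOfLE (le_sSup hV), hV⟩)
  have hsh := (isSheaf_iff_isSheaf_of_type _ _).1 A.property S hS
  exact ⟨(hsh.amalgamate (fun V f hf => Classical.choice hf)
    (fun _ _ _ _ _ _ _ _ _ _ => (hA _).elim _ _))⟩

/-- A compatible family of morphisms into `U` is no data at all, so subcanonicity only says that a
join of opens below `U` is below `U`. -/
instance : (frameTopology L).Subcanonical :=
  .of_isSheaf_yoneda_obj _ fun U W S hS x _ => by
    have hS' : sSup {V : L | ∃ f : V ⟶ W, S f} = W := hS
    have hWU : W ≤ U := by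
      rw [← hS']
      exact sSup_le fun V ⟨f, hf⟩ => leOfHom (x f hf)
    have hsub (V : L) : Subsingleton ((yoneda.obj U).obj (op V)) :=
      inferInstanceAs (Subsingleton (V ⟶ U))
    exact ⟨homOfLE hWU, fun _ _ _ => (hsub _).elim _ _, fun _ _ => (hsub _).elim _ _⟩

/-- The open `U` as a subterminal sheaf on `L`, namely the sheaf represented by `U`. -/
abbrev openSheaf (U : L) : LocaleSheaf L := (frameTopology L).yoneda.obj U

instance (U : L) (V : Lᵒᵖ) : Subsingleton ((openSheaf U).obj.obj V) :=
  inferInstanceAs (Subsingleton (V.unop ⟶ U))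

theorem openSheaf_hom_ext {A : LocaleSheaf L} {U : L} (f g : A ⟶ openSheaf U) : f = g := by
  ext V x
  exact Subsingleton.elim _ _

/-- A sheaf maps to `openSheaf U` as soon as it only has sections over parts of `U`. -/
def homOpenSheaf {A : LocaleSheaf L} {U : L} (h : ∀ V, A.obj.obj (op V) → V ≤ U) :
    A ⟶ openSheaf U :=
  ObjectProperty.homMk
    { app := fun V => ↾fun x => homOfLE (h V.unop x)
      naturality := fun _ _ _ => by ext x; exact Subsingleton.elim _ _ }

/-- The morphism from a represented sheaf given by a section. -/
def homOfSection {A : LocaleSheaf L} {U : L} (s : A.obj.obj (op U)) : openSheaf U ⟶ A :=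
  ObjectProperty.homMk (yonedaEquiv.symm s)

instance {A : LocaleSheaf L} {U : L} (f : openSheaf U ⟶ A) : Mono f :=
  ⟨fun _ _ _ => openSheaf_hom_ext _ _⟩

/-- The subobjects of the open `U`, regarded as a sheaf, are the opens below `U`. -/
noncomputable def iicOrderIsoSubobject (U : L) : Set.Iic U ≃o Subobject (openSheaf U) :=
  RelIso.ofSurjective
    (OrderEmbedding.ofMapLEIff
      (fun W : Set.Iic U => Subobject.mk ((frameTopology L).yoneda.map (homOfLE W.2)))
      fun V W => by
        constructor
        · intro h
          exact leOfHom ((frameTopology L).yonedaFullyFaithful.preimage (Subobject.ofMkLEMk _ _ h))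
        · intro h
          exact Subobject.mk_le_mk_of_comm
            ((frameTopology L).yoneda.map (homOfLE (show V.1 ≤ W.1 from h)))
            (openSheaf_hom_ext _ _))
    (fun A => by
      let B : LocaleSheaf L := A
      have hmono : Mono A.arrow.hom :=
        inferInstanceAs (Mono ((sheafToPresheaf (frameTopology L) (Type u)).map A.arrow))
      have hB : ∀ V, Subsingleton (B.obj.obj V) := fun V =>
        have h := (NatTrans.mono_iff_mono_app A.arrow.hom).1 hmono V
        ((mono_iff_injective _).1 h).subsingleton
      -- The subobject is represented by the largest open carrying a section of it.
      obtain ⟨s⟩ := nonempty_section_sSup B hB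
      have hU : sSup {V : L | Nonempty (B.obj.obj (op V))} ≤ U :=
        sSup_le fun V ⟨x⟩ => leOfHom (A.arrow.hom.app (op V) x)
      refine ⟨⟨_, hU⟩, le_antisymm ?_ ?_⟩
      · exact Subobject.mk_le_of_comm (homOfSection s) (openSheaf_hom_ext _ _)
      · exact Subobject.le_mk_of_comm (homOpenSheaf fun V x => le_sSup ⟨x⟩)
          (openSheaf_hom_ext _ _))

/-- The subobjects of a sheaf below the image of a section over `U` are the opens below `U`. -/
noncomputable def iicOrderIsoIicMk {F : LocaleSheaf L} {U : L} (f : openSheaf U ⟶ F) :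
    Set.Iic U ≃o Set.Iic (Subobject.mk f) :=
  (iicOrderIsoSubobject U).trans <|
    (Subobject.mapIsoToOrderIso (Subobject.underlyingIso f).symm).trans
      (Subobject.subobjectOrderIso _)

/-- The sheaves represented by the members of a cover stable under passing to smaller opens
generate the topos: a section is determined by its restrictions to such opens. -/
theorem isSeparating_openSheaf {D : Set L} (hD : IsLowerSet D) (hcov : sSup D = ⊤) :
    (ObjectProperty.ofObj fun V : D => openSheaf V.1).IsSeparating := by
  intro A B f g hfg
  ext U x
  let S : Sieve U.unop :=
    { arrows := fun V _ => V ∈ D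
      downward_closed := fun hV g => hD (leOfHom g) hV }
  have hS : S ∈ frameTopology L U.unop := by
    refine le_antisymm (sSup_le fun V ⟨f, _⟩ => leOfHom f) ?_
    have : U.unop ⊓ sSup D = U.unop := by rw [hcov, inf_top_eq]
    rw [inf_sSup_eq] at this
    conv_lhs => rw [← this]
    exact iSup₂_le fun V hV => le_sSup ⟨homOfLE inf_le_left, hD inf_le_right hV⟩
  refine ((isSheaf_iff_isSheaf_of_type _ _).1 B.property S hS).isSeparatedFor.ext fun V i hi => ?_
  have h := hfg _ (ObjectProperty.ofObj_apply (fun V : D => openSheaf V.1) ⟨V, hi⟩)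
    (homOfSection (A.obj.map i.op x))
  have hV := ConcreteCategory.congr_hom
    (NatTrans.congr_app ((sheafToPresheaf _ _).congr_map h) (op V)) (𝟙 V)
  simpa [homOfSection, yonedaEquiv] using hV

/-- The opens over which some member of a generating family has a section cover the locale: the
members of the family map into the subterminal sheaf given by their join, which they therefore
cannot tell apart from the terminal one. -/
theorem sSup_section_of_isSeparating {ι : Type v} {X : ι → LocaleSheaf L}
    (hX : (ObjectProperty.ofObj X).IsSeparating) :
    sSup {V : L | ∃ i, Nonempty ((X i).obj.obj (op V))} = ⊤ := by
  set W := sSup {V : L | ∃ i, Nonempty ((X i).obj.obj (op V))}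
  let e := (iicOrderIsoSubobject (⊤ : L))
  have h : e ⟨W, le_top⟩ = e ⟨⊤, le_rfl⟩ := by
    refine Subobject.eq_of_le_of_isDetecting hX.isDetecting _ _
      (e.monotone (show W ≤ ⊤ from le_top)) ?_
    rintro G ⟨i⟩ f -
    exact (Subobject.mk_factors_iff _ _).2
      ⟨homOpenSheaf fun V x => le_sSup ⟨i, ⟨x⟩⟩, openSheaf_hom_ext _ _⟩
  exact congrArg Subtype.val (e.injective h)

/-- An open over which a zero-dimensional sheaf has a section is zero-dimensional, since it is
isomorphic to an open part of the frame of subobjects. -/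
theorem IsZeroDimensionalObject.iic {F : LocaleSheaf L} (h : IsZeroDimensionalObject F) {U : L}
    (s : F.obj.obj (op U)) : IsZeroDimensional (Set.Iic U) := by
  let e := (closedSubfunctorOrderIso F).symm
  let A := Subobject.mk (homOfSection s)
  exact ((IsZeroDimensional.of_orderIso e h).Iic (e A)).of_orderIso
    ((e.iicCongr A).symm.trans (iicOrderIsoIicMk (homOfSection s)).symm)

end Locale

theorem mainTheorem10 (L : Type u) [Order.Frame L] :
    List.TFAE
      [IsLocallyZeroDimensional L,
       IsLocallyZeroDimensionalTopos (LocaleSheaf L),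
       ∀ F : LocaleSheaf L, IsLocallyZeroDimensionalObject F] := by
  -- The cover may be enlarged to a lower set, so that its members form a basis of `L`.
  have key : IsLocallyZeroDimensional L → ∃ D : Set L, IsLowerSet D ∧ sSup D = ⊤ ∧
      ∀ V ∈ D, IsZeroDimensional (Set.Iic V) := by
    intro h
    obtain ⟨𝒰, hcov, h𝒰⟩ := isLocallyZeroDimensional_iff.1 h
    exact ⟨lowerClosure 𝒰, (lowerClosure 𝒰).lower,
      top_le_iff.1 (hcov.ge.trans (sSup_le_sSup subset_lowerClosure)),
      fun V ⟨U, hU, hVU⟩ => (h𝒰 U hU).Iic_mono hVU⟩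
  tfae_have 1 → 2 := by
    intro h
    obtain ⟨D, hD, hcov, hzd⟩ := key h
    exact ⟨D, _, isSeparating_openSheaf hD hcov, fun V =>
      (hzd V.1 V.2).of_orderIso (iicOrderIsoSubobject V.1)⟩
  tfae_have 1 → 3 := by
    intro h F
    obtain ⟨D, hD, hcov, hzd⟩ := key h
    refine ⟨{A | ∃ V ∈ D, ∃ f : openSheaf V ⟶ F, A = Subobject.mk f},
      ⟨⊤, isTop_top, fun A _ => le_top, fun A hA => ?_⟩, ?_⟩
    -- A subobject through which all sections over members of `D` factor is the whole sheaf.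
    · refine (Subobject.eq_of_le_of_isDetecting (isSeparating_openSheaf hD hcov).isDetecting
        A ⊤ le_top ?_).ge
      rintro G ⟨V⟩ f -
      exact Subobject.factors_of_le f (hA ⟨V.1, V.2, f, rfl⟩) (Subobject.mk_factors_self f)
    · rintro _ ⟨V, hV, f, rfl⟩
      exact (hzd V hV).of_orderIso (iicOrderIsoIicMk f)
  tfae_have 2 → 1 := by
    rintro ⟨ι, X, hX, hzd⟩
    refine isLocallyZeroDimensional_iff.2 ⟨_, sSup_section_of_isSeparating hX, ?_⟩
    rintro V ⟨i, ⟨s⟩⟩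
    exact (hzd i).iic s
  tfae_have 3 → 1 := fun h =>
    (h (openSheaf ⊤)).of_orderIso ((iicOrderIsoSubobject ⊤).symm.trans OrderIso.IicTop)
  tfae_finish
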